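/- All graphs are finite and simple, and $e(G)$ denotes the number of edges of $G$. For a connected graph $G$ with at least two vertices, colour its edges (adjacent edges may receive the same colour). The colouring is a monochromatic disconnection colouring if for any two distinct vertices $u,v$ there is a set $X$ of vertices with $u\in X$, $v\notin X$ such that all edges with exactly one end in $X$ have the same colour. Let $\mathrm{md}(G)$ be the maximum number of colours used by a monochromatic disconnection colouring of $G$. Let $n$ and $r$ be integers with $1\le r\le n-1$. Let $f(n,r)$ be the least integer $m\ge n-1$ (every connected graph of order $n$ has at least $n-1$ edges) such that every connected graph $G$ with $n$ vertices and $e(G)\ge m$ satisfies $\mathrm{md}(G)\le r$. Then $$f(n,r)=\begin{cases}\binom{n-r+1}{2}-n+2r+1, & 1\le r\le n-2,\\ n-1, & r=n-1.\end{cases}$$ Moreover, if $1\le r\le n-2$, then $f(n,r)$ is also the least among all integers $m$ with this property, without the restriction $m\ge n-1$. -/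

import Mathlib

universe u

namespace SimpleGraph

variable {V : Type u}

/-- The edge-cut `∂(X)`: the edges of `G` with one end in `X` and the other end outside `X`. -/
def edgeCut (G : SimpleGraph V) (X : Set V) : Set G.edgeSet :=
  {e | ∃ x y : V, x ∈ X ∧ y ∉ X ∧ (e : Sym2 V) = s(x, y)}

/-- An edge-coloured graph is monochromatically disconnected if any two distinct vertices
are separated by an edge-cut all of whose edges have the same colour. -/
def IsMDColoring (G : SimpleGraph V) {K : Type*} (Γ : G.edgeSet → K) : Prop :=
  ∀ u v : V, u ≠ v → ∃ X : Set V, u ∈ X ∧ v ∉ X ∧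
    ∀ e ∈ G.edgeCut X, ∀ e' ∈ G.edgeCut X, Γ e = Γ e'

/-- The numbers `k` such that some MD-coloring of `G` uses exactly `k` colours
(adjacent edges may have the same colour). -/
def mdColorCounts (G : SimpleGraph V) : Set ℕ :=
  {k | ∃ Γ : G.edgeSet → Fin k, Function.Surjective Γ ∧ G.IsMDColoring Γ}

/-- The monochromatic disconnection number: the maximum number of colours in an MD-coloring.
By `isGreatest_mdNumber` the supremum is attained for finite connected graphs of order at
least two. -/
noncomputable def mdNumber (G : SimpleGraph V) : ℕ :=
  sSup G.mdColorCounts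

theorem isGreatest_mdNumber [Finite V] [Nontrivial V] (G : SimpleGraph V)
    (hG : G.Connected) : IsGreatest G.mdColorCounts G.mdNumber := by
  classical
  have hbdd : BddAbove G.mdColorCounts := by
    refine ⟨Nat.card G.edgeSet, ?_⟩
    rintro k ⟨Γ, hΓ, -⟩
    simpa using Nat.card_le_card_of_surjective Γ hΓ
  have hne : G.mdColorCounts.Nonempty := by
    obtain ⟨a⟩ := hG.nonempty
    obtain ⟨b, hb⟩ := hG.preconnected.exists_adj_of_nontrivial a
    refine ⟨1, fun _ => 0, fun c => ⟨⟨s(a, b), hb⟩, Subsingleton.elim _ _⟩, ?_⟩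
    intro u v huv
    exact ⟨{u}, rfl, fun h => huv h.symm, fun _ _ _ _ => rfl⟩
  exact ⟨Nat.sSup_mem hne hbdd, fun k hk => le_csSup hbdd hk⟩

/-- Every connected graph of order `n` with at least `m` edges has monochromatic
disconnection number at most `r`. -/
def EdgesForceMD (n r : ℕ) (m : ℤ) : Prop :=
  ∀ (V : Type u) [Finite V] (G : SimpleGraph V), Nat.card V = n → G.Connected →
    m ≤ (G.edgeSet.ncard : ℤ) → G.mdNumber ≤ r

end SimpleGraph

namespace SimpleGraph

open Finset

/-! Build the graph one vertex at a time, each new vertex adjacent to the connected set already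
built. A vertex with two neighbours in the set brings no new colour (`color_mem`), and one with a
single neighbour brings at most one. With `k` colours on `k + 1 + a` vertices, `a` counts the steps
that brought no colour. A step bringing a colour adds one edge. A step bringing none adds at most `a
+ 2` edges, by `card_colors_add_card_neighbors_le`. Summing gives at most `(a + 2).choose 2 - 1 + k`
edges. For fixed order this bound grows with `a`, so more than `r` colours allow at most `(n -
r).choose 2 + r` edges. A clique on `n - r` vertices with `r` pendant edges attains this when `r ≤ n
- 2`. -/

/-- A finite set of vertices is cut-connected if it is nonempty and each of its bipartitions into
nonempty parts is crossed by an edge. -/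
def CutConnected {V : Type u} (G : SimpleGraph V) (S : Finset V) : Prop :=
  S.Nonempty ∧ ∀ X : Set V, (∃ x ∈ S, x ∈ X) → (∃ y ∈ S, y ∉ X) →
    ∃ x ∈ S, ∃ y ∈ S, x ∈ X ∧ y ∉ X ∧ G.Adj x y

open Classical in
/-- The edges of `G` with both ends in `S`. -/
noncomputable def edgesWithin {V : Type u} (G : SimpleGraph V) (S : Finset V) :
    Finset (Sym2 V) :=
  S.sym2.filter (· ∈ G.edgeSet)

open Classical in
/-- The neighbours of `v` in `S`. -/
noncomputable def neighborsWithin {V : Type u} (G : SimpleGraph V) (v : V) (S : Finset V) :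
    Finset V :=
  S.filter (G.Adj v)

/-- The colours used by `col` on the edges of `G` with both ends in `S`. -/
noncomputable def colorsWithin {V : Type u} (G : SimpleGraph V) (col : Sym2 V → ℕ)
    (S : Finset V) : Finset ℕ :=
  (G.edgesWithin S).image col

/-- Any two distinct vertices are separated by a monochromatic cut, for a colouring of all
unordered pairs. -/
def HasMonochromaticCuts {V : Type u} (G : SimpleGraph V) (col : Sym2 V → ℕ) : Prop :=
  ∀ u v : V, u ≠ v → ∃ X : Set V, u ∈ X ∧ v ∉ X ∧
    ∀ x ∈ X, ∀ y ∉ X, ∀ x' ∈ X, ∀ y' ∉ X, G.Adj x y → G.Adj x' y' →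
      col s(x, y) = col s(x', y')

/-! ### Growing a connected vertex set -/

section Growth

variable {V : Type u} {G : SimpleGraph V} {col : Sym2 V → ℕ}

theorem mem_neighborsWithin {v w : V} {S : Finset V} :
    w ∈ G.neighborsWithin v S ↔ w ∈ S ∧ G.Adj v w := by
  simp [neighborsWithin]

theorem card_neighborsWithin_le (v : V) (S : Finset V) : #(G.neighborsWithin v S) ≤ #S :=
  card_le_card fun _ hw => (mem_neighborsWithin.1 hw).1

theorem mk_mem_edgesWithin {x y : V} {S : Finset V} :
    s(x, y) ∈ G.edgesWithin S ↔ (x ∈ S ∧ y ∈ S) ∧ G.Adj x y := by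
  simp [edgesWithin]

theorem edgesWithin_singleton (v : V) : G.edgesWithin {v} = ∅ := by
  ext e
  induction e with | _ x y
  rw [mk_mem_edgesWithin]
  simp only [Finset.mem_singleton, Finset.notMem_empty, iff_false]
  rintro ⟨⟨rfl, rfl⟩, h⟩
  exact G.loopless.irrefl _ h

theorem edgesWithin_insert [DecidableEq V] {v : V} {S : Finset V} (hv : v ∉ S) :
    G.edgesWithin (insert v S) =
      G.edgesWithin S ∪ (G.neighborsWithin v S).image (fun w => s(v, w)) := by
  ext e
  induction e with | _ x y
  rw [Finset.mem_union, mk_mem_edgesWithin, mk_mem_edgesWithin]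
  simp only [Finset.mem_insert, Finset.mem_image, mem_neighborsWithin, Sym2.eq_iff]
  constructor
  · rintro ⟨⟨rfl | hx, rfl | hy⟩, h⟩
    · exact absurd h (G.loopless.irrefl _)
    · exact Or.inr ⟨y, ⟨hy, h⟩, Or.inl ⟨rfl, rfl⟩⟩
    · exact Or.inr ⟨x, ⟨hx, h.symm⟩, Or.inr ⟨rfl, rfl⟩⟩
    · exact Or.inl ⟨⟨hx, hy⟩, h⟩
  · rintro (⟨⟨hx, hy⟩, h⟩ | ⟨w, ⟨hw, h⟩, ⟨rfl, rfl⟩ | ⟨rfl, rfl⟩⟩)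
    · exact ⟨⟨Or.inr hx, Or.inr hy⟩, h⟩
    · exact ⟨⟨Or.inl rfl, Or.inr hw⟩, h⟩
    · exact ⟨⟨Or.inr hw, Or.inl rfl⟩, h.symm⟩

theorem card_edgesWithin_insert_le [DecidableEq V] {v : V} {S : Finset V} (hv : v ∉ S) :
    #(G.edgesWithin (insert v S)) ≤ #(G.edgesWithin S) + #(G.neighborsWithin v S) := by
  rw [edgesWithin_insert hv]
  exact (card_union_le _ _).trans (by gcongr; exact card_image_le)

theorem colorsWithin_insert [DecidableEq V] {v : V} {S : Finset V} (hv : v ∉ S) :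
    G.colorsWithin col (insert v S) =
      G.colorsWithin col S ∪ (G.neighborsWithin v S).image (fun w => col s(v, w)) := by
  rw [colorsWithin, edgesWithin_insert hv, image_union, image_image]
  rfl

theorem card_colorsWithin_insert_le [DecidableEq V] {v : V} {S : Finset V} (hv : v ∉ S) :
    #(G.colorsWithin col (insert v S)) ≤
      #(G.colorsWithin col S) + #(G.neighborsWithin v S) := by
  rw [colorsWithin_insert hv]
  exact (card_union_le _ _).trans (by gcongr; exact card_image_le)

theorem subset_colorsWithin_insert [DecidableEq V] {v : V} {S : Finset V} (hv : v ∉ S) :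
    G.colorsWithin col S ⊆ G.colorsWithin col (insert v S) := by
  rw [colorsWithin_insert hv]
  exact subset_union_left

theorem cutConnected_singleton (v : V) : G.CutConnected {v} := by
  refine ⟨singleton_nonempty v, ?_⟩
  rintro X ⟨x, hx, hxX⟩ ⟨y, hy, hyX⟩
  rw [Finset.mem_singleton] at hx hy
  subst hx hy
  exact absurd hxX hyX

theorem CutConnected.insert [DecidableEq V] {S : Finset V} (hS : G.CutConnected S) {v w : V}
    (hw : w ∈ S) (hvw : G.Adj v w) : G.CutConnected (insert v S) := by
  refine ⟨insert_nonempty v S, ?_⟩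
  intro X hX hX'
  by_cases h1 : ∃ x ∈ S, x ∈ X
  · by_cases h2 : ∃ y ∈ S, y ∉ X
    · obtain ⟨x, hx, y, hy, h⟩ := hS.2 X h1 h2
      exact ⟨x, mem_insert_of_mem hx, y, mem_insert_of_mem hy, h⟩
    · push Not at h2
      obtain ⟨y, hy, hyX⟩ := hX'
      rcases Finset.mem_insert.1 hy with rfl | hy
      · exact ⟨w, mem_insert_of_mem hw, y, mem_insert_self _ _, h2 w hw, hyX, hvw.symm⟩
      · exact absurd (h2 y hy) hyX
  · push Not at h1
    obtain ⟨x, hx, hxX⟩ := hX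
    rcases Finset.mem_insert.1 hx with rfl | hx
    · exact ⟨x, mem_insert_self _ _, w, mem_insert_of_mem hw, hxX, h1 w hw, hvw⟩
    · exact absurd hxX (h1 x hx)

/-- A cut-connected set can be built from any of its vertices by adding adjacent vertices
one at a time. -/
theorem CutConnected.induction_on [DecidableEq V] {T : Finset V} (hT : G.CutConnected T)
    {a : V} (ha : a ∈ T) {P : Finset V → Prop} (base : P {a})
    (step : ∀ S : Finset V, S ⊆ T → G.CutConnected S → P S →
      ∀ u ∈ T, u ∉ S → ∀ w ∈ S, G.Adj u w → P (Insert.insert u S)) : P T := by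
  have key : ∀ m : ℕ, m + 1 ≤ #T → ∃ S ⊆ T, G.CutConnected S ∧ #S = m + 1 ∧ P S := by
    intro m
    induction m with
    | zero =>
      exact fun _ => ⟨{a}, by simpa using ha, cutConnected_singleton a, by simp, base⟩
    | succ m ih =>
      intro hm
      obtain ⟨S, hST, hS, hcard, hP⟩ := ih (by omega)
      obtain ⟨y, hy, hyS⟩ := exists_mem_notMem_of_card_lt_card (s := S) (t := T) (by omega)
      obtain ⟨b, hb⟩ := hS.1
      obtain ⟨x, -, z, hz, hxS, hzS, hadj⟩ :=
        hT.2 (S : Set V) ⟨b, hST hb, hb⟩ ⟨y, hy, hyS⟩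
      have hzS' : z ∉ S := hzS
      exact ⟨Insert.insert z S, insert_subset hz hST, hS.insert hxS hadj.symm,
        by rw [card_insert_of_notMem hzS', hcard],
        step S hST hS hP z hz hzS' x hxS hadj.symm⟩
  have hpos : 0 < #T := card_pos.2 hT.1
  obtain ⟨S, hST, -, hcard, hP⟩ := key (#T - 1) (by omega)
  rwa [← eq_of_subset_of_card_le hST (by omega)]

/-- If the colour of `uw` were absent from `S`, a cut separating `u` from `w` could not split `S`,
so `uw` and `uw'` would share a colour. A cut separating `w` from `w'` does split `S`, and it
contains `uw` or `uw'`, so that colour occurs in `S` after all. -/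
theorem HasMonochromaticCuts.color_mem (hcol : G.HasMonochromaticCuts col) {S : Finset V}
    (hS : G.CutConnected S) {u w w' : V} (hw : w ∈ S) (hw' : w' ∈ S) (hne : w ≠ w')
    (huw : G.Adj u w) (huw' : G.Adj u w') : col s(u, w) ∈ G.colorsWithin col S := by
  have hmem : ∀ {x y : V}, x ∈ S → y ∈ S → G.Adj x y → col s(x, y) ∈ G.colorsWithin col S :=
    fun hx hy h => mem_image_of_mem _ (mk_mem_edgesWithin.2 ⟨⟨hx, hy⟩, h⟩)
  by_contra hnot
  obtain ⟨X, huX, hwX, hX⟩ := hcol u w huw.ne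
  have hw'X : w' ∉ X := by
    intro hw'X
    obtain ⟨x, hx, y, hy, hxX, hyX, h⟩ := hS.2 X ⟨w', hw', hw'X⟩ ⟨w, hw, hwX⟩
    exact hnot (hX u huX w hwX x hxX y hyX huw h ▸ hmem hx hy h)
  have hsame : col s(u, w) = col s(u, w') := hX u huX w hwX u huX w' hw'X huw huw'
  obtain ⟨Y, hwY, hw'Y, hY⟩ := hcol w w' hne
  obtain ⟨x, hx, y, hy, hxY, hyY, h⟩ := hS.2 Y ⟨w, hw, hwY⟩ ⟨w', hw', hw'Y⟩
  apply hnot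
  by_cases huY : u ∈ Y
  · rw [hsame, hY u huY w' hw'Y x hxY y hyY huw' h]
    exact hmem hx hy h
  · rw [Sym2.eq_swap, hY w hwY u huY x hxY y hyY huw.symm h]
    exact hmem hx hy h

theorem HasMonochromaticCuts.colorsWithin_insert_eq [DecidableEq V]
    (hcol : G.HasMonochromaticCuts col) {S : Finset V} (hS : G.CutConnected S) {u : V}
    (hu : u ∉ S) (hcard : 2 ≤ #(G.neighborsWithin u S)) :
    G.colorsWithin col (insert u S) = G.colorsWithin col S := by
  rw [colorsWithin_insert hu, union_eq_left, image_subset_iff]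
  intro w hw
  obtain ⟨w', hw', hne⟩ := exists_mem_ne (show 1 < #(G.neighborsWithin u S) by omega) w
  rw [mem_neighborsWithin] at hw hw'
  exact hcol.color_mem hS hw.1 hw'.1 hne.symm hw.2 hw'.2

theorem HasMonochromaticCuts.card_colorsWithin_insert_le_succ [DecidableEq V]
    (hcol : G.HasMonochromaticCuts col) {S : Finset V} (hS : G.CutConnected S) {u : V}
    (hu : u ∉ S) :
    #(G.colorsWithin col (insert u S)) ≤ #(G.colorsWithin col S) + 1 := by
  by_cases h : 2 ≤ #(G.neighborsWithin u S)
  · rw [hcol.colorsWithin_insert_eq hS hu h]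
    omega
  · have := card_colorsWithin_insert_le (G := G) (col := col) hu
    omega

/-- A vertex attached to a connected set `T` of vertices misses at least as many vertices of `T`
as there are colours, less one. -/
theorem HasMonochromaticCuts.card_colors_add_card_neighbors_le [DecidableEq V]
    (hcol : G.HasMonochromaticCuts col) {T : Finset V} (hT : G.CutConnected T) {v a : V}
    (hv : v ∉ T) (ha : a ∈ T) (hva : G.Adj v a) :
    #(G.colorsWithin col (insert v T)) + #(G.neighborsWithin v T) ≤ #T + 1 := by
  suffices a ∈ T ∧
      #(G.colorsWithin col (insert v T)) + #(G.neighborsWithin v T) ≤ #T + 1 from this.2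
  refine hT.induction_on ha (P := fun T => a ∈ T ∧
      #(G.colorsWithin col (insert v T)) + #(G.neighborsWithin v T) ≤ #T + 1) ?_ ?_
  · refine ⟨mem_singleton_self a, ?_⟩
    have hva' : v ∉ ({a} : Finset V) := by simpa using hva.ne
    have h1 := card_colorsWithin_insert_le (G := G) (col := col) hva'
    have h2 : #(G.neighborsWithin v {a}) ≤ #({a} : Finset V) := card_neighborsWithin_le v {a}
    rw [colorsWithin, colorsWithin, edgesWithin_singleton] at h1
    rw [colorsWithin]
    simp only [image_empty, card_empty, card_singleton] at h1 h2 ⊢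
    omega
  · rintro S hST hS ⟨haS, ih⟩ u hu huS w hw huw
    refine ⟨mem_insert_of_mem haS, ?_⟩
    have hvS : v ∉ S := fun h => hv (hST h)
    have huv : u ≠ v := fun h => hv (h ▸ hu)
    have huS' : u ∉ insert v S := by simp [huv, huS]
    have hvS' : G.CutConnected (insert v S) := hS.insert haS hva
    rw [Finset.insert_comm, card_insert_of_notMem huS]
    -- The sum of colours and degree rises by at most one. If `u` is adjacent to `v`, the degree may
    -- rise, but the neighbours `v` and `w` of `u` rule out a new colour. Otherwise only a colour
    -- can be gained.
    by_cases h : G.Adj v u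
    · rw [hcol.colorsWithin_insert_eq hvS' huS']
      · have : G.neighborsWithin v (insert u S) ⊆ insert u (G.neighborsWithin v S) := by
          intro x
          simp only [mem_neighborsWithin, Finset.mem_insert]
          tauto
        have := (card_le_card this).trans (card_insert_le _ _)
        omega
      · have hvw : v ≠ w := fun h => hvS (h ▸ hw)
        rw [← card_pair hvw]
        refine card_le_card ?_
        intro x hx
        rw [mem_neighborsWithin]
        simp only [Finset.mem_insert, Finset.mem_singleton] at hx
        rcases hx with rfl | rfl
        · exact ⟨mem_insert_self _ _, h.symm⟩
        · exact ⟨mem_insert_of_mem hw, huw⟩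
    · have h1 := hcol.card_colorsWithin_insert_le_succ hvS' huS'
      have h2 : G.neighborsWithin v (insert u S) ⊆ G.neighborsWithin v S := by
        intro x
        simp only [mem_neighborsWithin, Finset.mem_insert]
        rintro ⟨rfl | hx, hvx⟩
        · exact absurd hvx h
        · exact ⟨hx, hvx⟩
      have := card_le_card h2
      omega

/-- Edge bound for a cut-connected set `T`: with `k` colours on `T` and `#T = k + 1 + a`, there are
at most `(a + 2).choose 2 + k - 1` edges. -/
theorem HasMonochromaticCuts.card_edgesWithin_lt [DecidableEq V]
    (hcol : G.HasMonochromaticCuts col) {T : Finset V} (hT : G.CutConnected T) :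
    ∃ a : ℕ, #T = #(G.colorsWithin col T) + 1 + a ∧
      #(G.edgesWithin T) + 1 ≤ (a + 2).choose 2 + #(G.colorsWithin col T) := by
  obtain ⟨b, hb⟩ := hT.1
  refine hT.induction_on hb (P := fun T => ∃ a : ℕ, #T = #(G.colorsWithin col T) + 1 + a ∧
      #(G.edgesWithin T) + 1 ≤ (a + 2).choose 2 + #(G.colorsWithin col T)) ?_ ?_
  · exact ⟨0, by simp [colorsWithin, edgesWithin_singleton]⟩
  · rintro S - hS ⟨a, hcard, hedge⟩ u - hu w hw huw
    have hle := card_edgesWithin_insert_le (G := G) hu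
    have hcl := card_colorsWithin_insert_le (G := G) (col := col) hu
    have hsub := card_le_card (subset_colorsWithin_insert (G := G) (col := col) hu)
    have hsucc := hcol.card_colorsWithin_insert_le_succ hS hu
    have hdeg := hcol.card_colors_add_card_neighbors_le hS hu hw huw
    have hpascal : (a + 3).choose 2 = (a + 2) + (a + 2).choose 2 := by
      rw [Nat.choose_succ_succ' (a + 2) 1, Nat.choose_one_right]
    rw [card_insert_of_notMem hu]
    -- Without a new colour, `hdeg` bounds the degree of `u` by `a + 2`, which is the Pascal
    -- increment. With one, the degree is at most 1 and `a` is unchanged.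
    rcases hsub.eq_or_lt with heq | hlt
    · refine ⟨a + 1, by omega, ?_⟩
      rw [show a + 1 + 2 = a + 3 from rfl, hpascal]
      omega
    · have hdeg1 : #(G.neighborsWithin u S) < 2 := by
        by_contra h
        rw [hcol.colorsWithin_insert_eq hS hu (by omega)] at hlt
        exact lt_irrefl _ hlt
      exact ⟨a, by omega, by omega⟩

end Growth

/-! ### The edge bound for a whole graph -/

theorem Connected.cutConnected_univ {V : Type u} [Fintype V] {G : SimpleGraph V}
    (hG : G.Connected) : G.CutConnected Finset.univ := by
  obtain ⟨b⟩ := hG.nonempty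
  refine ⟨⟨b, mem_univ b⟩, ?_⟩
  rintro X ⟨x, -, hx⟩ ⟨y, -, hy⟩
  obtain ⟨p⟩ := hG.preconnected x y
  obtain ⟨d, -, h1, h2⟩ := p.exists_boundary_dart X hx hy
  exact ⟨d.fst, mem_univ _, d.snd, mem_univ _, h1, h2, d.adj⟩

/-- A connected graph with an MD-colouring in `k` colours has order `k + 1 + a` for some `a`, and
at most `(a + 2).choose 2 + k - 1` edges. -/
theorem Connected.ncard_edgeSet_lt_of_mem_mdColorCounts {V : Type u} [Finite V]
    {G : SimpleGraph V} (hG : G.Connected) {k : ℕ} (hk : k ∈ G.mdColorCounts) :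
    ∃ a : ℕ, Nat.card V = k + 1 + a ∧ G.edgeSet.ncard + 1 ≤ (a + 2).choose 2 + k := by
  classical
  have := Fintype.ofFinite V
  obtain ⟨Γ, hsurj, hΓ⟩ := hk
  -- The value 0 on non-edges is harmless: cuts and `colorsWithin` see only edges.
  let col : Sym2 V → ℕ := fun e => if h : e ∈ G.edgeSet then (Γ ⟨e, h⟩ : ℕ) else 0
  have hcolΓ : ∀ e (h : e ∈ G.edgeSet), col e = Γ ⟨e, h⟩ := fun e h => dif_pos h
  have hcol : G.HasMonochromaticCuts col := by
    intro u v huv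
    obtain ⟨X, huX, hvX, hX⟩ := hΓ u v huv
    refine ⟨X, huX, hvX, fun x hx y hy x' hx' y' hy' h h' => ?_⟩
    rw [hcolΓ _ h, hcolΓ _ h']
    exact congrArg Fin.val
      (hX ⟨s(x, y), h⟩ ⟨x, y, hx, hy, rfl⟩ ⟨s(x', y'), h'⟩ ⟨x', y', hx', hy', rfl⟩)
  have hmem : ∀ e, e ∈ G.edgesWithin univ ↔ e ∈ G.edgeSet := by
    intro e
    simp [edgesWithin]
  have hcolors : G.colorsWithin col univ = range k := by
    ext i
    simp only [colorsWithin, Finset.mem_image, Finset.mem_range, hmem]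
    constructor
    · rintro ⟨e, he, rfl⟩
      rw [hcolΓ e he]
      exact (Γ ⟨e, he⟩).2
    · intro hi
      obtain ⟨⟨e, he⟩, h⟩ := hsurj ⟨i, hi⟩
      exact ⟨e, he, by rw [hcolΓ e he, h]⟩
  have hedges : G.edgeSet.ncard = #(G.edgesWithin univ) := by
    rw [← Set.ncard_coe_finset]
    congr 1
    ext e
    exact (hmem e).symm
  have := hcol.card_edgesWithin_lt hG.cutConnected_univ
  rwa [hcolors, card_range, ← hedges, card_univ, ← Nat.card_eq_fintype_card] at this

/-- Makes the edge bound monotone in `a` when `k + a` is fixed: raising `a` by one gains `a + 2` and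
loses one colour. -/
theorem choose_two_add_le {a b : ℕ} (hab : a ≤ b) :
    (a + 2).choose 2 + b ≤ (b + 2).choose 2 + a := by
  induction b, hab using Nat.le_induction with
  | base => exact le_rfl
  | succ b hab ih =>
    have : (b + 3).choose 2 = (b + 2) + (b + 2).choose 2 := by
      rw [Nat.choose_succ_succ' (b + 2) 1, Nat.choose_one_right]
    rw [show b + 1 + 2 = b + 3 from rfl, this]
    omega

/-! ### The extremal graph -/

/-- The complete graph on the first `p` of `n` vertices, with all further vertices
attached by pendant edges to vertex `0`. -/
def cliqueWithPendants (n p : ℕ) : SimpleGraph (ULift.{u} (Fin n)) where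
  Adj x y := x ≠ y ∧
    (x.down.val = 0 ∨ y.down.val = 0 ∨ (x.down.val < p ∧ y.down.val < p))
  symm := ⟨fun _ _ h => ⟨h.1.symm, by tauto⟩⟩
  loopless := ⟨fun _ h => h.1 rfl⟩

theorem cliqueWithPendants_connected {n p : ℕ} (hn : 0 < n) :
    (cliqueWithPendants.{u} n p).Connected := by
  have key : ∀ x, (cliqueWithPendants.{u} n p).Reachable ⟨⟨0, hn⟩⟩ x := by
    intro x
    by_cases h : (⟨⟨0, hn⟩⟩ : ULift.{u} (Fin n)) = x
    · rw [h]
    · exact Adj.reachable ⟨h, Or.inl rfl⟩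
  exact { preconnected := fun x y => (key x).symm.trans (key y), nonempty := ⟨⟨⟨0, hn⟩⟩⟩ }

theorem le_ncard_edgeSet_cliqueWithPendants {r p : ℕ} (hp : 0 < p) :
    p.choose 2 + r ≤ (cliqueWithPendants.{u} (p + r) p).edgeSet.ncard := by
  classical
  let G := cliqueWithPendants.{u} (p + r) p
  let inc : Fin p → ULift.{u} (Fin (p + r)) := fun i => ⟨Fin.castAdd r i⟩
  let pend : Fin r → ULift.{u} (Fin (p + r)) := fun i => ⟨Fin.natAdd p i⟩
  let zero : ULift.{u} (Fin (p + r)) := ⟨⟨0, by omega⟩⟩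
  have hinc : Function.Injective inc := fun i j h =>
    Fin.castAdd_injective p r (ULift.up_injective h)
  have hpend : Function.Injective pend := fun i j h => by
    simpa [pend] using h
  let C : Finset (ULift.{u} (Fin (p + r))) := univ.image inc
  let A : Finset (Sym2 (ULift.{u} (Fin (p + r)))) := C.offDiag.image Sym2.mk.uncurry
  let B : Finset (Sym2 (ULift.{u} (Fin (p + r)))) := univ.image (fun i => s(zero, pend i))
  have hC : ∀ x, x ∈ C → x.down.val < p := by
    intro x hx
    obtain ⟨i, -, rfl⟩ := Finset.mem_image.1 hx
    exact i.2
  have hA : #A = p.choose 2 := by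
    have : #C = p := by rw [card_image_of_injective _ hinc, card_univ, Fintype.card_fin]
    exact (Sym2.card_image_offDiag C).trans (by rw [this])
  have hB : #B = r := by
    rw [card_image_of_injective, card_univ, Fintype.card_fin]
    intro i j h
    exact hpend (Sym2.congr_right.1 h)
  have hdisj : Disjoint A B := by
    rw [Finset.disjoint_left]
    rintro e heA heB
    obtain ⟨⟨x, y⟩, hxy, rfl⟩ := Finset.mem_image.1 heA
    obtain ⟨i, -, h⟩ := Finset.mem_image.1 heB
    rw [mem_offDiag] at hxy
    replace h : s(zero, pend i) = s(x, y) := h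
    have : pend i ∈ s(x, y) := h ▸ Sym2.mem_mk_right _ _
    have hlt : (pend i).down.val < p := by
      rcases Sym2.mem_iff.1 this with h | h
      · exact h ▸ hC x hxy.1
      · exact h ▸ hC y hxy.2.1
    simp [pend] at hlt
  have hsub : ((A ∪ B : Finset _) : Set (Sym2 _)) ⊆ G.edgeSet := by
    intro e he
    rcases Finset.mem_union.1 he with he | he
    · obtain ⟨⟨x, y⟩, hxy, rfl⟩ := Finset.mem_image.1 he
      rw [mem_offDiag] at hxy
      exact ⟨hxy.2.2, Or.inr (Or.inr ⟨hC x hxy.1, hC y hxy.2.1⟩)⟩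
    · obtain ⟨i, -, rfl⟩ := Finset.mem_image.1 he
      refine ⟨fun h => ?_, Or.inl rfl⟩
      have : (0 : ℕ) = p + i := congrArg (fun x => x.down.val) h
      omega
  calc p.choose 2 + r = #(A ∪ B) := by rw [card_union_of_disjoint hdisj, hA, hB]
    _ = ((A ∪ B : Finset _) : Set (Sym2 _)).ncard := (Set.ncard_coe_finset _).symm
    _ ≤ _ := Set.ncard_le_ncard hsub (Set.toFinite _)

/-- The pendant edges get distinct colours, and the clique another one. -/
theorem succ_mem_mdColorCounts_cliqueWithPendants {r p : ℕ} (hp : 2 ≤ p) :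
    r + 1 ∈ (cliqueWithPendants.{u} (p + r) p).mdColorCounts := by
  classical
  -- Truncated subtraction sends every clique edge to 0, and the pendant edge at vertex `p + i` to
  -- `i + 1`.
  let f : ULift.{u} (Fin (p + r)) → ULift.{u} (Fin (p + r)) → Fin (r + 1) := fun x y =>
    ⟨max x.down.val y.down.val - (p - 1), by
      have := x.down.2
      have := y.down.2
      omega⟩
  let c : Sym2 (ULift.{u} (Fin (p + r))) → Fin (r + 1) :=
    Sym2.lift ⟨f, fun x y => by simp only [f, max_comm]⟩
  have hc : ∀ x y, (c s(x, y) : ℕ) = max x.down.val y.down.val - (p - 1) := fun _ _ => rfl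
  refine ⟨fun e => c e, ?_, ?_⟩
  · intro i
    refine ⟨⟨s(⟨⟨0, by omega⟩⟩, ⟨⟨p - 1 + i, by omega⟩⟩), ?_, Or.inl rfl⟩, ?_⟩
    · intro h
      have : 0 = p - 1 + i.val := congrArg (fun x => x.down.val) h
      omega
    · apply Fin.ext
      rw [hc]
      simp
  -- The star at any vertex other than 0 is monochromatic, so it can serve as the cut; at least one
  -- of `u`, `v` is such a vertex.
  · have star : ∀ w x y : ULift.{u} (Fin (p + r)), w.down.val ≠ 0 →
        (cliqueWithPendants.{u} (p + r) p).Adj w x →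
        (cliqueWithPendants.{u} (p + r) p).Adj w y → c s(w, x) = c s(w, y) := by
      rintro w x y hw ⟨-, hx⟩ ⟨-, hy⟩
      apply Fin.ext
      rw [hc, hc]
      omega
    intro u v huv
    by_cases hu : u.down.val = 0
    · have hv : v.down.val ≠ 0 := by
        intro hv
        exact huv (ULift.ext _ _ (Fin.ext (hu.trans hv.symm)))
      refine ⟨{v}ᶜ, huv, fun h => h rfl, ?_⟩
      rintro ⟨_, he⟩ ⟨x, y, hx, hy, rfl⟩ ⟨_, he'⟩ ⟨x', y', hx', hy', rfl⟩
      obtain rfl : y = v := by simpa using hy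
      obtain rfl : y' = y := by simpa using hy'
      have := star y' x x' hv (Adj.symm he) (Adj.symm he')
      simpa only [Sym2.eq_swap (a := y')] using this
    · refine ⟨{u}, rfl, fun h => huv h.symm, ?_⟩
      rintro ⟨_, he⟩ ⟨x, y, hx, hy, rfl⟩ ⟨_, he'⟩ ⟨x', y', hx', hy', rfl⟩
      obtain rfl : x = u := hx
      obtain rfl : x' = x := hx'
      exact star x' y y' hu he he'

/-! ### The threshold -/

/-- Every connected graph of order `n` with more than `(n - r).choose 2 + r` edges has
monochromatic disconnection number at most `r` (here `p = n - r`). -/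
theorem edgesForceMD_of_lt {r p : ℕ} (hr : 1 ≤ r) (hp : 1 ≤ p) {m : ℤ}
    (hm : ((p.choose 2 + r : ℕ) : ℤ) < m) : EdgesForceMD.{u} (p + r) r m := by
  intro V _ G hcard hG hedge
  have : Nontrivial V := Finite.one_lt_card_iff_nontrivial.1 (by omega)
  obtain ⟨a, ha, he⟩ := hG.ncard_edgeSet_lt_of_mem_mdColorCounts (isGreatest_mdNumber G hG).1
  by_contra! hlt
  -- More than `r` colours on `p + r` vertices force `a ≤ p - 2`, and `a = p - 2` is the extremal
  -- case.
  obtain ⟨b, rfl⟩ : ∃ b, p = b + 2 := ⟨p - 2, by omega⟩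
  have := choose_two_add_le (show a ≤ b by omega)
  omega

theorem lt_of_edgesForceMD {r p : ℕ} (hp : 2 ≤ p) {m : ℤ}
    (hm : EdgesForceMD.{u} (p + r) r m) : ((p.choose 2 + r : ℕ) : ℤ) < m := by
  by_contra! hle
  have : Nontrivial (ULift.{u} (Fin (p + r))) :=
    Finite.one_lt_card_iff_nontrivial.1 (by simp; omega)
  have hconn := cliqueWithPendants_connected.{u} (n := p + r) (p := p) (by omega)
  have hedge := le_ncard_edgeSet_cliqueWithPendants.{u} (r := r) (p := p) (by omega)
  have h1 := hm _ (cliqueWithPendants.{u} (p + r) p) (by simp) hconn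
    (hle.trans (by exact_mod_cast hedge))
  have h2 := (isGreatest_mdNumber _ hconn).2
    (succ_mem_mdColorCounts_cliqueWithPendants.{u} (r := r) hp)
  omega

end SimpleGraph

theorem theorem3p3 (n r : ℕ) (hr : 1 ≤ r) (hrn : r + 1 ≤ n) :
    IsLeast {m : ℤ | (n : ℤ) - 1 ≤ m ∧ SimpleGraph.EdgesForceMD.{u} n r m}
      (if r + 2 ≤ n then ((n - r + 1).choose 2 : ℤ) - n + 2 * r + 1 else (n : ℤ) - 1) ∧
    (r + 2 ≤ n →
      IsLeast {m : ℤ | SimpleGraph.EdgesForceMD.{u} n r m}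
        (((n - r + 1).choose 2 : ℤ) - n + 2 * r + 1)) := by
  obtain ⟨p, rfl⟩ : ∃ p, n = p + r := ⟨n - r, by omega⟩
  have hval : ((p + r - r + 1).choose 2 : ℤ) - (p + r : ℕ) + 2 * r + 1 =
      ((p.choose 2 + r : ℕ) : ℤ) + 1 := by
    rw [Nat.add_sub_cancel, Nat.choose_succ_succ' p 1, Nat.choose_one_right]
    push_cast
    ring
  have hleast : r + 2 ≤ p + r → IsLeast {m : ℤ | SimpleGraph.EdgesForceMD.{u} (p + r) r m}
      (((p + r - r + 1).choose 2 : ℤ) - (p + r : ℕ) + 2 * r + 1) := by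
    intro h
    rw [hval]
    exact ⟨SimpleGraph.edgesForceMD_of_lt hr (by omega) (by omega),
      fun m hm => SimpleGraph.lt_of_edgesForceMD (by omega) hm⟩
  refine ⟨?_, hleast⟩
  split_ifs with h
  · refine ⟨⟨?_, (hleast h).1⟩, fun m hm => (hleast h).2 hm.2⟩
    -- The threshold is at least `n - 1` because `(q + 1).choose 2 ≥ q`.
    obtain ⟨q, rfl⟩ : ∃ q, p = q + 1 := ⟨p - 1, by omega⟩
    rw [hval, Nat.choose_succ_succ' q 1, Nat.choose_one_right]
    push_cast
    omega
  -- Here `r = n - 1`, and no colouring uses more than `n - 1` colours.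
  · refine ⟨⟨le_rfl, ?_⟩, fun m hm => hm.1⟩
    intro V _ G hcard hG _
    have : Nontrivial V := Finite.one_lt_card_iff_nontrivial.1 (by omega)
    obtain ⟨a, ha, -⟩ :=
      hG.ncard_edgeSet_lt_of_mem_mdColorCounts (SimpleGraph.isGreatest_mdNumber G hG).1
    omega
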